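/- Let $\Omega\subseteq\mathbb{R}^d$ be compact and let $K:\Omega\times\Omega\to\mathbb{R}$ be a continuous symmetric positive semidefinite kernel with reproducing kernel Hilbert space $\mathcal{H}_K$. Let $$w_K(n)=\inf_{L}\ \sup_{x\in\Omega}\ \inf_{f\in L}\|K(x,\cdot)-f\|_{\mathcal{H}_K},$$ where $L$ ranges over the linear subspaces of $\mathcal{H}_K$ of dimension at most $n$, be the Kolmogorov $n$-width of the image of $\Omega$ in $\mathcal{H}_K$. For a Borel probability measure $\mu$ on $\Omega$ let $\mathrm{O}_{K,\mu}:L_2(\Omega,\mu)\to L_2(\Omega,\mu)$ be given by $\mathrm{O}_{K,\mu}\phi(x)=\int_\Omega K(x,y)\phi(y)\,d\mu(y)$, and let $\lambda_1(\mathrm{O}_{K,\mu})\ge\lambda_2(\mathrm{O}_{K,\mu})\ge\cdots$ be its eigenvalues, counted with multiplicity (with $\lambda_n=0$ if there are fewer than $n$ positive eigenvalues). 1. For every Borel probability measure $\mu$ on $\Omega$ and every $n\ge 1$, $$\lambda_{2n}(\mathrm{O}_{K,\mu})\le \frac{w_K(n)^2}{n}.$$ 2. Suppose that $w_K(n)>0$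 for all $n$ (equivalently, that $\mathcal{H}_K$ is infinite-dimensional), so that the quotients below are defined. Then $$\limsup_{n\to\infty}\ \sup_{\mu}\ \frac{n\,\lambda_n(\mathrm{O}_{K,\mu})}{w_K(n)^2}\ \ge\ \frac1e,$$ where the supremum is over all Borel probability measures $\mu$ on $\Omega$ and the limsup may be $+\infty$. 3. Under the assumption of part 2, there are sequences $x_1,x_2,\dots$ in $\Omega$ that are greedy, in the sense that for each $n\ge 0$ the point $x_{n+1}$ maximizes, over $x\in\Omega$, the determinant of the kernel matrix of the points $x_1,\dots,x_n,x$ (for $n=0$: $x_1$ maximizes $K(x,x)$); and for every greedy sequence the empirical measures $\mu_m=\frac1m\sum_{i=1}^m\delta_{x_i}$ satisfy $$\limsup_{n\to\infty}\ \sup_{m\ge 1}\ \frac{n\,\lambda_n(\mathrm{O}_{K,\mu_m})}{w_K(n)^2}\ \ge\ \frac1e.$$ -/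

import Mathlib

open MeasureTheory Filter
open scoped ENNReal

noncomputable section

/-! ### Kernels and their reproducing kernel Hilbert spaces -/

/-- A real kernel `K` on `X` is positive semidefinite: it is symmetric and
`∑ᵢⱼ cᵢ cⱼ K(xᵢ, xⱼ) ≥ 0` for all finite families of points and real coefficients. -/
def IsPosSemidefKernel {X : Type*} (K : X × X → ℝ) : Prop :=
  (∀ x y : X, K (x, y) = K (y, x)) ∧
    ∀ (n : ℕ) (x : Fin n → X) (c : Fin n → ℝ), 0 ≤ ∑ i, ∑ j, c i * c j * K (x i, x j)

/-- The kernel `K` as an operator-valued kernel on the one-dimensional space `ℝ`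
(multiplication by the number `K(x, y)`). -/
def kernelMatrix {X : Type*} (K : X × X → ℝ) : Matrix X X (ℝ →L[ℝ] ℝ) :=
  Matrix.of fun x y => K (x, y) • ContinuousLinearMap.id ℝ ℝ

theorem posSemidef_kernelMatrix {X : Type*} {K : X × X → ℝ} (hK : IsPosSemidefKernel K) :
    (kernelMatrix K).PosSemidef := by
  have hsym : (kernelMatrix K).IsHermitian := by
    ext x y
    have h : star (ContinuousLinearMap.id ℝ ℝ) = ContinuousLinearMap.id ℝ ℝ :=
      star_one (ℝ →L[ℝ] ℝ)
    simp [kernelMatrix, Matrix.conjTranspose_apply, h, hK.1 x y]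
  have htfae := (RKHS.posSemidef_tfae (K := kernelMatrix K)).out 0 2
  refine htfae.mpr ⟨hsym, fun vv => ?_⟩
  have h := hK.2 vv.support.card (fun i => (vv.support.equivFin.symm i : X))
    (fun i => vv (vv.support.equivFin.symm i : X))
  have h2 : ∀ g : X → ℝ, ∑ i : Fin vv.support.card, g (vv.support.equivFin.symm i : X)
      = ∑ x ∈ vv.support, g x := fun g => by
    rw [← Finset.sum_coe_sort vv.support g]
    exact Equiv.sum_comp vv.support.equivFin.symm (fun x : vv.support => g x)
  have h3 : (∑ i : Fin vv.support.card, ∑ j : Fin vv.support.card,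
        vv (vv.support.equivFin.symm i : X) * vv (vv.support.equivFin.symm j : X) *
          K ((vv.support.equivFin.symm i : X), (vv.support.equivFin.symm j : X)))
      = ∑ x ∈ vv.support, ∑ y ∈ vv.support, vv x * vv y * K (x, y) := by
    rw [← h2 (fun x => ∑ y ∈ vv.support, vv x * vv y * K (x, y))]
    exact Finset.sum_congr rfl fun i _ =>
      h2 (fun y => vv (vv.support.equivFin.symm i : X) * vv y *
        K ((vv.support.equivFin.symm i : X), y))
  rw [h3] at h
  refine h.trans_eq ?_
  simp only [Finsupp.sum, RCLike.re_to_real]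
  refine Finset.sum_congr rfl fun x _ => Finset.sum_congr rfl fun y _ => ?_
  simp [kernelMatrix, hK.1 x y]
  ring

/-- The image `{K(x, ·) : x ∈ X}` of `X` in the reproducing kernel Hilbert space of `K`. -/
def featureSet {X : Type*} (K : X × X → ℝ) [Fact (kernelMatrix K).PosSemidef] :
    Set (RKHS.OfKernel (kernelMatrix K)) :=
  Set.range fun x : X => RKHS.kerFun (RKHS.OfKernel (kernelMatrix K)) x (1 : ℝ)

/-- The element `K(x, ·)` of the Hilbert space is, as a function, `y ↦ K(y, x) = K(x, y)`. -/
theorem kerFun_kernelMatrix {X : Type*} (K : X × X → ℝ) [Fact (kernelMatrix K).PosSemidef]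
    (x y : X) :
    RKHS.kerFun (RKHS.OfKernel (kernelMatrix K)) x (1 : ℝ) y = K (y, x) := by
  rw [RKHS.kerFun_apply, RKHS.OfKernel.kernel_ofKernel]
  simp [kernelMatrix]

/-! ### Kolmogorov widths -/

/-- The Kolmogorov `n`-width of a subset `A` of a normed space `E`: the infimum over the linear
subspaces `L` of dimension at most `n` of `sup_{a ∈ A} inf_{f ∈ L} ‖a - f‖`. -/
def kolmogorovWidth {E : Type*} [NormedAddCommGroup E] [NormedSpace ℝ E] (A : Set E) (n : ℕ) : ℝ :=
  ⨅ L : {L : Submodule ℝ E // FiniteDimensional ℝ L ∧ Module.finrank ℝ L ≤ n},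
    ⨆ a : A, ⨅ f : L.1, ‖(a : E) - (f : E)‖

/-- The number `w_K(n)`: the Kolmogorov `n`-width of the image of `X` in the reproducing kernel
Hilbert space of `K`. -/
def kernelWidth {X : Type*} (K : X × X → ℝ) (hK : IsPosSemidefKernel K) (n : ℕ) : ℝ :=
  haveI : Fact (kernelMatrix K).PosSemidef := ⟨posSemidef_kernelMatrix hK⟩
  kolmogorovWidth (featureSet K) n

/-! ### The integral operator and its eigenvalues -/

section IntegralOperator

variable {X : Type*} [TopologicalSpace X] [CompactSpace X] [MeasurableSpace X] [BorelSpace X]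

theorem integrable_kernel_mul (K : C(X × X, ℝ)) (μ : Measure X) [IsFiniteMeasure μ]
    (φ : Lp ℝ 2 μ) (x : X) : Integrable (fun y => K (x, y) * φ y) μ := by
  have hφ : Integrable φ μ := (Lp.memLp φ).integrable (by norm_num)
  have hc : Continuous fun y => K (x, y) := by fun_prop
  refine hφ.bdd_mul (c := ‖K‖) hc.measurable.aestronglyMeasurable ?_
  exact Eventually.of_forall fun y => K.norm_coe_le_norm (x, y)

theorem continuous_integral_kernel_mul [FirstCountableTopology X]
    (K : C(X × X, ℝ)) (μ : Measure X) [IsFiniteMeasure μ]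
    (φ : Lp ℝ 2 μ) : Continuous fun x => ∫ y, K (x, y) * φ y ∂μ := by
  have hφ : Integrable φ μ := (Lp.memLp φ).integrable (by norm_num)
  refine continuous_of_dominated (bound := fun y => ‖K‖ * ‖φ y‖)
    (fun x => (integrable_kernel_mul K μ φ x).aestronglyMeasurable) (fun x => ?_)
    (hφ.norm.const_mul _) ?_
  · refine Eventually.of_forall fun y => ?_
    rw [norm_mul]
    exact mul_le_mul_of_nonneg_right (K.norm_coe_le_norm (x, y)) (norm_nonneg _)
  · exact Eventually.of_forall fun y => by fun_prop

/-- The map `φ ↦ (x ↦ ∫ K(x, y) φ(y) dμ(y))`, as a linear map from `L²(μ)` to `C(X)`. -/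
def integralToContinuous [FirstCountableTopology X]
    (K : C(X × X, ℝ)) (μ : Measure X) [IsFiniteMeasure μ] :
    Lp ℝ 2 μ →ₗ[ℝ] C(X, ℝ) where
  toFun φ := ⟨fun x => ∫ y, K (x, y) * φ y ∂μ, continuous_integral_kernel_mul K μ φ⟩
  map_add' φ ψ := by
    ext x
    simp only [ContinuousMap.coe_mk, ContinuousMap.add_apply]
    rw [← integral_add (integrable_kernel_mul K μ φ x) (integrable_kernel_mul K μ ψ x)]
    refine integral_congr_ae ?_
    filter_upwards [Lp.coeFn_add φ ψ] with y hy
    rw [hy, Pi.add_apply, mul_add]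
  map_smul' c φ := by
    ext x
    simp only [ContinuousMap.coe_mk, ContinuousMap.smul_apply, RingHom.id_apply, smul_eq_mul]
    rw [← integral_const_mul]
    refine integral_congr_ae ?_
    filter_upwards [Lp.coeFn_smul c φ] with y hy
    rw [hy, Pi.smul_apply, smul_eq_mul]
    ring

/-- The integral operator `O_{K,μ} φ (x) = ∫ K(x, y) φ(y) dμ(y)` on `L²(μ)`. -/
def integralOperator [FirstCountableTopology X]
    (K : C(X × X, ℝ)) (μ : Measure X) [IsFiniteMeasure μ] :
    Lp ℝ 2 μ →ₗ[ℝ] Lp ℝ 2 μ :=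
  (ContinuousMap.toLp 2 μ ℝ : C(X, ℝ) →L[ℝ] Lp ℝ 2 μ).toLinearMap ∘ₗ integralToContinuous K μ

theorem integralOperator_apply_ae [FirstCountableTopology X]
    (K : C(X × X, ℝ)) (μ : Measure X) [IsFiniteMeasure μ] (φ : Lp ℝ 2 μ) :
    integralOperator K μ φ =ᵐ[μ] fun x => ∫ y, K (x, y) * φ y ∂μ :=
  ContinuousMap.coeFn_toLp (p := 2) (𝕜 := ℝ) μ (integralToContinuous K μ φ)

end IntegralOperator

/-- The `n`-th eigenvalue `λ_n(T)` (`n ≥ 1`) of a compact positive semidefinite self-adjoint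
operator `T`, in nonincreasing order and counted with multiplicity: the largest `t > 0` such that
the eigenvalues of `T` that are at least `t` have total multiplicity at least `n`, that is, such
that there are `n` linearly independent eigenvectors with eigenvalues at least `t`. If `T` has
fewer than `n` positive eigenvalues, counted with multiplicity, then `λ_n(T) = 0`. -/
def nthEigenvalue {E : Type*} [AddCommGroup E] [Module ℝ E] (T : E →ₗ[ℝ] E) (n : ℕ) : ℝ :=
  sSup {t : ℝ | 0 < t ∧ ∃ v : Fin n → E, LinearIndependent ℝ v ∧
    ∀ i, ∃ s : ℝ, t ≤ s ∧ T (v i) = s • v i}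

/-! ### Greedy sequences and empirical measures -/

/-- The sequence `x 0, x 1, …` is greedy for `K`: each `x n` maximizes over `y ∈ X` the determinant
of the kernel matrix of the `n + 1` points `x 0, …, x (n - 1), y`. (For `n = 0`: `x 0` maximizes
`K(y, y)`.) -/
def IsGreedySequence {X : Type*} (K : X × X → ℝ) (x : ℕ → X) : Prop :=
  ∀ n : ℕ, IsMaxOn (fun y : X =>
    (Matrix.of fun i j : Fin (n + 1) =>
      K ((Fin.snoc (fun k : Fin n => x k) y : Fin (n + 1) → X) i,
        (Fin.snoc (fun k : Fin n => x k) y : Fin (n + 1) → X) j)).det) Set.univ (x n)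

/-- The empirical measure `(1/m) ∑_{i < m} δ_{x i}` of the first `m` points of a sequence. -/
def empiricalMeasure {X : Type*} [MeasurableSpace X] (x : ℕ → X) (m : ℕ+) : Measure X :=
  ((m : ℕ) : ℝ≥0∞)⁻¹ • ∑ i ∈ Finset.range (m : ℕ), Measure.dirac (x i)

instance isProbabilityMeasure_empiricalMeasure {X : Type*} [MeasurableSpace X] (x : ℕ → X)
    (m : ℕ+) :
    IsProbabilityMeasure (empiricalMeasure x m) := by
  constructor
  simp only [empiricalMeasure, Measure.smul_apply, Measure.finsetSum_apply, measure_univ,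
    Finset.sum_const, Finset.card_range, nsmul_eq_mul, mul_one, smul_eq_mul]
  exact ENNReal.inv_mul_cancel (by simp) (by simp)

end

/-! Put Φ x = K(x, ·) and S φ = ∫ φ Φ dμ, so that O = S*S (`inner_integralOperator`).

Upper bound: let Φ stay within r of a subspace L of dimension at most n, and let V be spanned by 2n
independent eigenvectors with eigenvalues at least t. The vectors of V that S maps into Lᗮ form a
subspace of dimension at least n. Each unit vector in it contributes at least t to the trace of O
there, and this trace is at most r², because only the part of Φ orthogonal to L matters. Hence n t ≤
r² (`sub_mul_le_sq_of_eigenvectors`).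

Lower bound: a Gram determinant is the product of the squared distances of each vector from the span
of its predecessors (`det_gram_succ`). The greedy choice maximizes each distance over Ω, so the k-th
is at least w(k). Comparing the kernel matrix divided by m with O for the empirical measure gives
∏_{k<m} w(k)² ≤ m^m ∏_{k≤m} λ_k. If n λ_n ≤ c w(n)² for all large n and all m, with c e < 1, the
right side is at most a constant times c^m (m^m / m!) ∏_{k<m} w(k)². Since m^m / m! ≤ e^m, letting m
grow is a contradiction. Part 2 follows, as empirical measures are probability measures. -/

/-! ### Feature maps and the trace bound. -/

open scoped InnerProductSpace in
/-- On the span of eigenvectors of a symmetric operator with eigenvalues at least `t`, the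
quadratic form of the operator is at least `t` times the squared norm. -/
theorem mul_norm_sq_le_inner_of_mem_span_eigenvectors {E : Type*} [NormedAddCommGroup E]
    [InnerProductSpace ℝ E] {T : E →ₗ[ℝ] E} (hT : T.IsSymmetric) {t : ℝ} {n : ℕ}
    {v : Fin n → E} {s : Fin n → ℝ} (hs : ∀ i, t ≤ s i) (hv : ∀ i, T (v i) = s i • v i)
    {φ : E} (hφ : φ ∈ Submodule.span ℝ (Set.range v)) :
    t * ‖φ‖ ^ 2 ≤ ⟪T φ, φ⟫_ℝ := by
  obtain ⟨c, rfl⟩ := (Submodule.mem_span_range_iff_exists_fun ℝ).1 hφ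
  -- The `v i` need not be orthogonal, but they are when eigenvalues differ. Hence ⟪T φ, φ⟫ - t ‖φ‖²
  -- is the squared norm of ∑ cᵢ √(sᵢ - t) vᵢ.
  have key : ∀ i j, (s i - t) * ⟪v i, v j⟫_ℝ
      = √(s i - t) * √(s j - t) * ⟪v i, v j⟫_ℝ := by
    intro i j
    have h := hT (v i) (v j)
    rw [hv, hv, real_inner_smul_left, real_inner_smul_right] at h
    rcases eq_or_ne (s i) (s j) with hij | hij
    · rw [← hij, Real.mul_self_sqrt (sub_nonneg.2 (hs i))]
    · have : ⟪v i, v j⟫_ℝ = 0 := by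
        have : (s i - s j) * ⟪v i, v j⟫_ℝ = 0 := by linarith
        exact (mul_eq_zero.1 this).resolve_left (sub_ne_zero.2 hij)
      simp [this]
  have h0 : 0 ≤ ⟪∑ i, (c i * √(s i - t)) • v i, ∑ j, (c j * √(s j - t)) • v j⟫_ℝ :=
    real_inner_self_nonneg
  have h1 : ⟪∑ i, (c i * √(s i - t)) • v i, ∑ j, (c j * √(s j - t)) • v j⟫_ℝ
      = ⟪T (∑ i, c i • v i), ∑ i, c i • v i⟫_ℝ - t * ‖∑ i, c i • v i‖ ^ 2 := by
    rw [← real_inner_self_eq_norm_sq]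
    simp only [map_sum, map_smul, hv, sum_inner, inner_sum, real_inner_smul_left,
      real_inner_smul_right, Finset.mul_sum]
    rw [← Finset.sum_sub_distrib]
    refine Finset.sum_congr rfl fun i _ => ?_
    rw [← Finset.sum_sub_distrib]
    refine Finset.sum_congr rfl fun j _ => ?_
    linear_combination -(c i * c j) * key j i
  linarith

/-- A map `Φ` into an inner product space represents `K` if `⟪Φ x, Φ y⟫ = K(x, y)`. -/
structure IsFeatureMap {X H : Type*} [TopologicalSpace X] [NormedAddCommGroup H]
    [InnerProductSpace ℝ H] (K : C(X × X, ℝ)) (Φ : X → H) : Prop where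
  inner_eq : ∀ x y, inner ℝ (Φ x) (Φ y) = K (x, y)

namespace IsFeatureMap

variable {X H : Type*} [TopologicalSpace X] [NormedAddCommGroup H] [InnerProductSpace ℝ H]
  {K : C(X × X, ℝ)} {Φ : X → H}

theorem norm_sq (h : IsFeatureMap K Φ) (x : X) : ‖Φ x‖ ^ 2 = K (x, x) := by
  rw [← real_inner_self_eq_norm_sq, h.inner_eq]

theorem continuous (h : IsFeatureMap K Φ) : Continuous Φ := by
  rw [continuous_iff_continuousAt]
  intro x
  have h1 : Tendsto (fun y => K (y, y) - 2 * K (y, x) + K (x, x)) (nhds x) (nhds 0) := by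
    have : Continuous fun y => K (y, y) - 2 * K (y, x) + K (x, x) := by fun_prop
    convert this.tendsto x using 2
    ring
  have h2 : ∀ y, ‖Φ y - Φ x‖ ^ 2 = K (y, y) - 2 * K (y, x) + K (x, x) := by
    intro y
    rw [norm_sub_sq_real, h.norm_sq, h.norm_sq, h.inner_eq]
  rw [ContinuousAt, tendsto_iff_norm_sub_tendsto_zero]
  have h3 := h1.sqrt
  simp only [← h2, Real.sqrt_sq (norm_nonneg _), Real.sqrt_zero] at h3
  exact h3

variable [CompactSpace X]

theorem norm_sq_le (h : IsFeatureMap K Φ) (x : X) : ‖Φ x‖ ^ 2 ≤ ‖K‖ := by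
  rw [h.norm_sq]
  exact (le_abs_self _).trans (K.norm_coe_le_norm (x, x))

theorem norm_le (h : IsFeatureMap K Φ) (x : X) : ‖Φ x‖ ≤ √‖K‖ :=
  Real.le_sqrt_of_sq_le (h.norm_sq_le x)

variable [SecondCountableTopology X] [MeasurableSpace X] [BorelSpace X]
  (μ : Measure X) [IsProbabilityMeasure μ]

theorem integrable_smul (h : IsFeatureMap K Φ) (φ : Lp ℝ 2 μ) :
    Integrable (fun y => φ y • Φ y) μ := by
  have hφ : Integrable φ μ := (Lp.memLp φ).integrable (by norm_num)
  exact hφ.smul_bdd √‖K‖ h.continuous.aestronglyMeasurable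
    (Eventually.of_forall h.norm_le)

variable [CompleteSpace H]

/-- The adjoint `φ ↦ ∫ φ(y) Φ(y) dμ(y)` of the embedding of `H` into `L²(μ)`. -/
noncomputable def synthesis (h : IsFeatureMap K Φ) : Lp ℝ 2 μ →ₗ[ℝ] H where
  toFun φ := ∫ y, φ y • Φ y ∂μ
  map_add' φ ψ := by
    rw [← integral_add (h.integrable_smul μ φ) (h.integrable_smul μ ψ)]
    refine integral_congr_ae ?_
    filter_upwards [Lp.coeFn_add φ ψ] with y hy
    rw [hy, Pi.add_apply, add_smul]
  map_smul' c φ := by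
    rw [RingHom.id_apply, ← integral_smul]
    refine integral_congr_ae ?_
    filter_upwards [Lp.coeFn_smul c φ] with y hy
    rw [hy, Pi.smul_apply, smul_eq_mul, mul_smul]

theorem inner_synthesis (h : IsFeatureMap K Φ) (φ : Lp ℝ 2 μ) (a : H) :
    inner ℝ a (h.synthesis μ φ) = ∫ y, φ y * inner ℝ a (Φ y) ∂μ := by
  change inner ℝ a (∫ y, φ y • Φ y ∂μ) = _
  rw [← integral_inner (h.integrable_smul μ φ)]
  simp only [real_inner_smul_right]

/-- The factorization O = S*S; symmetry follows, and the quadratic form becomes ‖S φ‖². -/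
theorem inner_integralOperator (h : IsFeatureMap K Φ) (φ ψ : Lp ℝ 2 μ) :
    inner ℝ (integralOperator K μ φ) ψ
      = inner ℝ (h.synthesis μ φ) (h.synthesis μ ψ) := by
  rw [h.inner_synthesis μ, L2.inner_def]
  refine integral_congr_ae ?_
  filter_upwards [integralOperator_apply_ae K μ φ] with x hx
  rw [hx, real_inner_comm _ (h.synthesis μ φ), h.inner_synthesis μ]
  simp only [RCLike.inner_apply, conj_trivial, h.inner_eq, mul_comm (φ _)]

theorem isSymmetric_integralOperator (h : IsFeatureMap K Φ) :
    (integralOperator K μ).IsSymmetric := fun φ ψ => by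
  rw [h.inner_integralOperator μ, real_inner_comm, ← h.inner_integralOperator μ, real_inner_comm]

/-- The trace of the integral operator on a finite orthonormal system whose image under the
synthesis operator is orthogonal to `L` is bounded by the squared deviation of `Φ` from `L`. -/
theorem sum_norm_sq_synthesis_le (h : IsFeatureMap K Φ) {L : Submodule ℝ H} {r : ℝ}
    (hr : ∀ x, ∃ p ∈ L, ‖Φ x - p‖ ≤ r) {ι : Type*} [Fintype ι] {φ : ι → Lp ℝ 2 μ}
    (hφ : Orthonormal ℝ φ) (hL : ∀ i, h.synthesis μ (φ i) ∈ Lᗮ) :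
    ∑ i, ‖h.synthesis μ (φ i)‖ ^ 2 ≤ r ^ 2 := by
  set S := h.synthesis μ with hS
  set W : Submodule ℝ H := Submodule.span ℝ (Set.range fun i => S (φ i)) with hW
  have hWL : W ≤ Lᗮ := Submodule.span_le.2 (by rintro _ ⟨i, rfl⟩; exact hL i)
  have : FiniteDimensional ℝ W := FiniteDimensional.span_of_finite ℝ (Set.finite_range _)
  set e := stdOrthonormalBasis ℝ W with he
  have heo : Orthonormal ℝ fun j => (e j : H) := e.orthonormal.comp_linearIsometry W.subtypeₗᵢ
  have hcont : ∀ j, Continuous fun y => inner ℝ (e j : H) (Φ y) := fun j =>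
    continuous_const.inner h.continuous
  let g : Fin (Module.finrank ℝ W) → C(X, ℝ) := fun j => ⟨_, hcont j⟩
  let G : Fin (Module.finrank ℝ W) → Lp ℝ 2 μ := fun j => ContinuousMap.toLp 2 μ ℝ (g j)
  have hG : ∀ j, G j =ᵐ[μ] fun y => inner ℝ (e j : H) (Φ y) := fun j =>
    ContinuousMap.coeFn_toLp (p := 2) (𝕜 := ℝ) μ (g j)
  -- Parseval in W: `G j` is `e j` viewed in L²(μ), and S is adjoint to this embedding.
  have h1 : ∀ i, ‖S (φ i)‖ ^ 2 = ∑ j, ‖inner ℝ (φ i) (G j)‖ ^ 2 := by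
    intro i
    have hi : S (φ i) ∈ W := Submodule.subset_span ⟨i, rfl⟩
    have h2 := e.sum_sq_norm_inner_right ⟨S (φ i), hi⟩
    rw [Submodule.coe_norm] at h2
    rw [← h2]
    refine Finset.sum_congr rfl fun j _ => ?_
    congr 2
    rw [Submodule.coe_inner, h.inner_synthesis μ, L2.inner_def]
    refine integral_congr_ae ?_
    filter_upwards [hG j] with y hy
    rw [hy]
    simp [mul_comm]
  have h2 : ∀ j, ‖G j‖ ^ 2 = ∫ y, (inner ℝ (e j : H) (Φ y)) ^ 2 ∂μ := by
    intro j
    rw [← real_inner_self_eq_norm_sq, L2.inner_def]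
    refine integral_congr_ae ?_
    filter_upwards [hG j] with y hy
    rw [hy]
    simp [sq]
  have hint : ∀ f : C(X, ℝ), Integrable f μ := fun f =>
    f.continuous.integrable_of_hasCompactSupport (HasCompactSupport.of_compactSpace _)
  have hint' : ∀ j, Integrable (fun y => (inner ℝ (e j : H) (Φ y)) ^ 2) μ := fun j =>
    hint ⟨_, (hcont j).pow 2⟩
  -- Since `e j` is orthogonal to L, the approximant p can be subtracted from Φ y before applying
  -- Bessel in H.
  have h3 : ∀ y, ∑ j, (inner ℝ (e j : H) (Φ y)) ^ 2 ≤ r ^ 2 := by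
    intro y
    obtain ⟨p, hp, hpr⟩ := hr y
    have h4 : ∀ j, (inner ℝ (e j : H) (Φ y)) ^ 2 = ‖inner ℝ (e j : H) (Φ y - p)‖ ^ 2 := by
      intro j
      have : inner ℝ (e j : H) p = 0 :=
        Submodule.inner_left_of_mem_orthogonal hp (hWL (e j).2)
      rw [inner_sub_right, this, sub_zero, Real.norm_eq_abs, sq_abs]
    calc _ = ∑ j, ‖inner ℝ (e j : H) (Φ y - p)‖ ^ 2 := Finset.sum_congr rfl fun j _ => h4 j
      _ ≤ ‖Φ y - p‖ ^ 2 := heo.sum_inner_products_le _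
      _ ≤ r ^ 2 := by gcongr
  calc ∑ i, ‖S (φ i)‖ ^ 2 = ∑ i, ∑ j, ‖inner ℝ (φ i) (G j)‖ ^ 2 :=
        Finset.sum_congr rfl fun i _ => h1 i
    _ = ∑ j, ∑ i, ‖inner ℝ (φ i) (G j)‖ ^ 2 := Finset.sum_comm
    _ ≤ ∑ j, ‖G j‖ ^ 2 := Finset.sum_le_sum fun j _ => hφ.sum_inner_products_le _
    _ = ∑ j, ∫ y, (inner ℝ (e j : H) (Φ y)) ^ 2 ∂μ := Finset.sum_congr rfl fun j _ => h2 j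
    _ = ∫ y, ∑ j, (inner ℝ (e j : H) (Φ y)) ^ 2 ∂μ :=
        (integral_finsetSum _ fun j _ => hint' j).symm
    _ ≤ ∫ _, r ^ 2 ∂μ :=
        integral_mono (integrable_finsetSum _ fun j _ => hint' j) (integrable_const _) h3
    _ = r ^ 2 := by simp

/-- If `Φ` stays within `r` of a `k`-dimensional subspace and the integral operator has `n` linearly
independent eigenvectors with eigenvalues at least `t`, then `(n - k) t ≤ r²`. -/
theorem sub_mul_le_sq_of_eigenvectors (h : IsFeatureMap K Φ) {L : Submodule ℝ H}
    [FiniteDimensional ℝ L] {k n : ℕ} (hk : Module.finrank ℝ L ≤ k) {r : ℝ}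
    (hr : ∀ x, ∃ p ∈ L, ‖Φ x - p‖ ≤ r) {t : ℝ} (ht : 0 ≤ t) {v : Fin n → Lp ℝ 2 μ}
    (hli : LinearIndependent ℝ v)
    (hv : ∀ i, ∃ s : ℝ, t ≤ s ∧ integralOperator K μ (v i) = s • v i) :
    ((n : ℝ) - k) * t ≤ r ^ 2 := by
  choose s hs hvs using hv
  set V := Submodule.span ℝ (Set.range v) with hV
  have : FiniteDimensional ℝ V := FiniteDimensional.span_of_finite ℝ (Set.finite_range _)
  have hVn : Module.finrank ℝ V = n := by
    rw [finrank_span_eq_card hli, Fintype.card_fin]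
  -- The kernel of A consists of the vectors of V sent into Lᗮ; by rank-nullity its dimension is at
  -- least n - k.
  let A : V →ₗ[ℝ] L := L.orthogonalProjectionOnto.toLinearMap ∘ₗ h.synthesis μ ∘ₗ V.subtype
  have hrk := A.finrank_range_add_finrank_ker
  have hrange : Module.finrank ℝ A.range ≤ k := (Submodule.finrank_le _).trans hk
  let e := stdOrthonormalBasis ℝ A.ker
  let φ : Fin (Module.finrank ℝ A.ker) → Lp ℝ 2 μ := fun i => ((e i : V) : Lp ℝ 2 μ)
  have hφ : Orthonormal ℝ φ :=
    (e.orthonormal.comp_linearIsometry A.ker.subtypeₗᵢ).comp_linearIsometry V.subtypeₗᵢ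
  have hL : ∀ i, h.synthesis μ (φ i) ∈ Lᗮ := fun i => by
    have : A (e i : V) = 0 := (e i).2
    exact Submodule.orthogonalProjectionOnto_eq_zero_iff.1 this
  have h1 := h.sum_norm_sq_synthesis_le μ hr hφ hL
  have h2 : ∀ i, t ≤ ‖h.synthesis μ (φ i)‖ ^ 2 := fun i => by
    have := mul_norm_sq_le_inner_of_mem_span_eigenvectors (h.isSymmetric_integralOperator μ)
      hs hvs (e i : V).2
    rw [h.inner_integralOperator μ, real_inner_self_eq_norm_sq] at this
    have hn : ‖((e i : V) : Lp ℝ 2 μ)‖ = 1 := hφ.1 i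
    rwa [hn, one_pow, mul_one] at this
  have h3 : (Module.finrank ℝ A.ker : ℝ) * t ≤ r ^ 2 := by
    refine le_trans ?_ h1
    simpa using Finset.sum_le_sum fun i (_ : i ∈ Finset.univ) => h2 i
  refine le_trans (mul_le_mul_of_nonneg_right ?_ ht) h3
  have : (n : ℝ) ≤ k + Module.finrank ℝ A.ker := by exact_mod_cast (by omega)
  linarith

end IsFeatureMap

/-! ### Kolmogorov widths and the upper bound. -/

theorem nthEigenvalue_nonneg {E : Type*} [AddCommGroup E] [Module ℝ E] (T : E →ₗ[ℝ] E) (n : ℕ) :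
    0 ≤ nthEigenvalue T n :=
  Real.sSup_nonneg fun _ ht => ht.1.le

theorem kolmogorovWidth_nonneg {E : Type*} [NormedAddCommGroup E] [NormedSpace ℝ E] (A : Set E)
    (n : ℕ) : 0 ≤ kolmogorovWidth A n :=
  Real.iInf_nonneg fun _ => Real.iSup_nonneg fun _ => Real.iInf_nonneg fun _ => norm_nonneg _

section Width

variable {X H : Type*} [NormedAddCommGroup H] [InnerProductSpace ℝ H] {Φ : X → H}

theorem kolmogorovWidth_range_le {L : Submodule ℝ H} [FiniteDimensional ℝ L] {n : ℕ}
    (hL : Module.finrank ℝ L ≤ n) {r : ℝ} (hr : 0 ≤ r)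
    (h : ∀ x, ‖Φ x - L.starProjection (Φ x)‖ ≤ r) :
    kolmogorovWidth (Set.range Φ) n ≤ r := by
  refine (ciInf_le ⟨0, ?_⟩ (⟨L, inferInstance, hL⟩ :
    {L : Submodule ℝ H // FiniteDimensional ℝ L ∧ Module.finrank ℝ L ≤ n})).trans ?_
  · rintro _ ⟨L', rfl⟩
    exact Real.iSup_nonneg fun _ => Real.iInf_nonneg fun _ => norm_nonneg _
  · refine Real.iSup_le ?_ hr
    rintro ⟨_, x, rfl⟩
    rw [← Submodule.starProjection_minimal]
    exact h x

/-- The infimum over L need not be attained, hence r strictly above the width. The bound C is needed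
because an unbounded real supremum is 0 by convention. -/
theorem exists_submodule_of_kolmogorovWidth_lt {C : ℝ} (hC : ∀ x, ‖Φ x‖ ≤ C) {n : ℕ} {r : ℝ}
    (h : kolmogorovWidth (Set.range Φ) n < r) :
    ∃ L : Submodule ℝ H, FiniteDimensional ℝ L ∧ Module.finrank ℝ L ≤ n ∧
      ∀ x, ∃ p ∈ L, ‖Φ x - p‖ ≤ r := by
  have : Nonempty {L : Submodule ℝ H // FiniteDimensional ℝ L ∧ Module.finrank ℝ L ≤ n} :=
    ⟨⟨⊥, inferInstance, by simp⟩⟩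
  obtain ⟨⟨L, hLf, hLn⟩, hL⟩ := exists_lt_of_ciInf_lt h
  refine ⟨L, hLf, hLn, fun x => ⟨L.starProjection (Φ x), ?_, ?_⟩⟩
  · exact Submodule.starProjection_apply_mem L (Φ x)
  · rw [Submodule.starProjection_minimal]
    refine le_trans ?_ hL.le
    refine le_ciSup (f := fun a : Set.range Φ => ⨅ f : L, ‖(a : H) - (f : H)‖) ⟨C, ?_⟩
      ⟨Φ x, x, rfl⟩
    rintro _ ⟨⟨_, y, rfl⟩, rfl⟩
    refine (ciInf_le ⟨0, ?_⟩ 0).trans ?_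
    · rintro _ ⟨_, rfl⟩
      exact norm_nonneg _
    · simpa using hC y

end Width

theorem IsFeatureMap.kolmogorovWidth_sq_le {X H : Type*} [TopologicalSpace X]
    [CompactSpace X] [NormedAddCommGroup H] [InnerProductSpace ℝ H] {K : C(X × X, ℝ)} {Φ : X → H}
    (h : IsFeatureMap K Φ) (n : ℕ) :
    kolmogorovWidth (Set.range Φ) n ^ 2 ≤ ‖K‖ := by
  have h1 : kolmogorovWidth (Set.range Φ) n ≤ √‖K‖ :=
    kolmogorovWidth_range_le (L := ⊥) (by simp) (Real.sqrt_nonneg _)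
      (fun x => by simpa using h.norm_le x)
  exact (Real.le_sqrt (kolmogorovWidth_nonneg _ _) (norm_nonneg _)).1 h1

namespace IsFeatureMap

variable {X H : Type*} [TopologicalSpace X] [CompactSpace X] [SecondCountableTopology X]
  [MeasurableSpace X] [BorelSpace X] [NormedAddCommGroup H] [InnerProductSpace ℝ H]
  [CompleteSpace H] {K : C(X × X, ℝ)} {Φ : X → H}

/-- The trace bound with L = ⊥. It also bounds the set whose supremum is `nthEigenvalue`; for n = 0
that set is unbounded. -/
theorem mul_le_norm_of_eigenvectors (h : IsFeatureMap K Φ) (μ : Measure X)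
    [IsProbabilityMeasure μ] {n : ℕ} {t : ℝ}
    (ht : 0 ≤ t) {v : Fin n → Lp ℝ 2 μ} (hli : LinearIndependent ℝ v)
    (hv : ∀ i, ∃ s : ℝ, t ≤ s ∧ integralOperator K μ (v i) = s • v i) :
    n * t ≤ ‖K‖ := by
  have := h.sub_mul_le_sq_of_eigenvectors μ (L := ⊥) (k := 0) (by simp)
    (fun x => ⟨0, by simp, by simpa using h.norm_le x⟩) ht hli hv
  rwa [Nat.cast_zero, sub_zero, Real.sq_sqrt (norm_nonneg _)] at this

theorem mul_nthEigenvalue_le (h : IsFeatureMap K Φ) (μ : Measure X) [IsProbabilityMeasure μ]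
    {n : ℕ} (hn : 1 ≤ n) : n * nthEigenvalue (integralOperator K μ) n ≤ ‖K‖ := by
  have hn0 : (0 : ℝ) < n := by exact_mod_cast hn
  rw [mul_comm, ← le_div_iff₀ hn0]
  refine Real.sSup_le ?_ (by positivity)
  rintro t ⟨ht, v, hli, hv⟩
  rw [le_div_iff₀ hn0, mul_comm]
  exact h.mul_le_norm_of_eigenvectors μ ht.le hli hv

theorem le_nthEigenvalue (h : IsFeatureMap K Φ) (μ : Measure X) [IsProbabilityMeasure μ]
    {n : ℕ} (hn : 1 ≤ n) {t : ℝ} (ht : 0 < t) {v : Fin n → Lp ℝ 2 μ}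
    (hli : LinearIndependent ℝ v)
    (hv : ∀ i, ∃ s : ℝ, t ≤ s ∧ integralOperator K μ (v i) = s • v i) :
    t ≤ nthEigenvalue (integralOperator K μ) n := by
  refine le_csSup ⟨‖K‖ / n, ?_⟩ ⟨ht, v, hli, hv⟩
  rintro s ⟨hs, w, hw, hw'⟩
  rw [le_div_iff₀ (by exact_mod_cast hn), mul_comm]
  exact h.mul_le_norm_of_eigenvectors μ hs.le hw hw'

theorem nthEigenvalue_two_mul_le (h : IsFeatureMap K Φ) (μ : Measure X)
    [IsProbabilityMeasure μ] {n : ℕ} (hn : 1 ≤ n) :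
    nthEigenvalue (integralOperator K μ) (2 * n)
      ≤ kolmogorovWidth (Set.range Φ) n ^ 2 / n := by
  have hn0 : (0 : ℝ) < n := by exact_mod_cast hn
  refine Real.sSup_le ?_ (by positivity)
  rintro t ⟨ht, v, hli, hv⟩
  have h1 : ∀ r, kolmogorovWidth (Set.range Φ) n < r → √(n * t) ≤ r := by
    intro r hr
    obtain ⟨L, hLf, hLn, hL⟩ := exists_submodule_of_kolmogorovWidth_lt h.norm_le hr
    have h2 := h.sub_mul_le_sq_of_eigenvectors μ hLn hL ht.le hli hv
    have h3 : ((2 * n : ℕ) : ℝ) - n = n := by push_cast; ring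
    rw [h3] at h2
    exact Real.sqrt_le_iff.2 ⟨(kolmogorovWidth_nonneg _ _).trans hr.le, h2⟩
  have h4 : √(n * t) ≤ kolmogorovWidth (Set.range Φ) n := le_of_forall_gt_imp_ge_of_dense h1
  rw [le_div_iff₀ hn0, mul_comm]
  exact (Real.sqrt_le_iff.1 h4).2

end IsFeatureMap

/-! ### Gram determinants and greedy sequences. -/

section Gram

variable {H : Type*} [NormedAddCommGroup H] [InnerProductSpace ℝ H]

instance finiteDimensional_span_range {ι : Type*} [Finite ι] (p : ι → H) :
    FiniteDimensional ℝ (Submodule.span ℝ (Set.range p)) :=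
  FiniteDimensional.span_of_finite ℝ (Set.finite_range p)

/-- A Gram determinant is multiplied by the squared distance of the last vector from the span of
the others. -/
theorem det_gram_succ {n : ℕ} (p : Fin (n + 1) → H) :
    (Matrix.gram ℝ p).det = (Matrix.gram ℝ fun i : Fin n => p i.castSucc).det *
      ‖p (Fin.last n) - (Submodule.span ℝ (Set.range fun i : Fin n => p i.castSucc)).starProjection
        (p (Fin.last n))‖ ^ 2 := by
  set L := Submodule.span ℝ (Set.range fun i : Fin n => p i.castSucc) with hL
  set q := L.starProjection (p (Fin.last n)) with hq
  have hqL : q ∈ L := Submodule.starProjection_apply_mem L _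
  obtain ⟨a, ha⟩ := (Submodule.mem_span_range_iff_exists_fun ℝ).1 hqL
  have horth : p (Fin.last n) - q ∈ Lᗮ := Submodule.sub_starProjection_mem_orthogonal _
  -- Subtracting ∑ aₖ · row k from the last row keeps the determinant and leaves the entries ⟪p_last
  -- - q, p_j⟫, zero except for the last.
  let c : Fin (n + 1) → ℝ := Fin.snoc (fun k => -a k) 1
  have hrow : ∀ j, (∑ k, c k • Matrix.gram ℝ p k) j = inner ℝ (p (Fin.last n) - q) (p j) := by
    intro j
    rw [Finset.sum_apply, Fin.sum_univ_castSucc]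
    simp only [c, Fin.snoc_castSucc, Fin.snoc_last, Pi.smul_apply, Matrix.gram_apply, smul_eq_mul,
      neg_mul, Finset.sum_neg_distrib, one_mul]
    rw [← ha, inner_sub_left, sum_inner]
    simp only [real_inner_smul_left]
    ring
  have h1 := Matrix.det_updateRow_sum (Matrix.gram ℝ p) (Fin.last n) c
  rw [show c (Fin.last n) = 1 by simp [c], one_smul] at h1
  rw [← h1, Matrix.det_succ_row _ (Fin.last n), Fin.sum_univ_castSucc]
  have hmem : ∀ j : Fin n, p j.castSucc ∈ L := fun j => Submodule.subset_span ⟨j, rfl⟩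
  have h2 : ∀ j : Fin n, (-1 : ℝ) ^ ((Fin.last n : ℕ) + (j.castSucc : ℕ)) *
      (Matrix.gram ℝ p).updateRow (Fin.last n) (∑ k, c k • Matrix.gram ℝ p k) (Fin.last n)
        j.castSucc *
      (((Matrix.gram ℝ p).updateRow (Fin.last n) (∑ k, c k • Matrix.gram ℝ p k)).submatrix
        (Fin.last n).succAbove j.castSucc.succAbove).det = 0 := by
    intro j
    rw [Matrix.updateRow_self, hrow, Submodule.inner_left_of_mem_orthogonal (hmem j) horth]
    ring
  rw [Finset.sum_eq_zero fun j _ => h2 j, zero_add, Matrix.updateRow_self, hrow, ← two_mul,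
    pow_mul, neg_one_sq, one_pow, one_mul, mul_comm]
  congr 1
  · congr 1
    ext i j
    simp [Matrix.gram_apply]
  · rw [← real_inner_self_eq_norm_sq, inner_sub_right (p (Fin.last n) - q),
      Submodule.inner_left_of_mem_orthogonal hqL horth, sub_zero]

end Gram

/-- The sequence in which each term is computed by `f` from the list of the preceding terms. -/
def recursiveSequence {X : Type*} (f : ∀ n : ℕ, (Fin n → X) → X) (n : ℕ) : X :=
  f n fun k => recursiveSequence f k
termination_by n
decreasing_by exact k.isLt

theorem exists_isGreedySequence {X : Type*} [TopologicalSpace X] [CompactSpace X] [Nonempty X]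
    (K : C(X × X, ℝ)) : ∃ x : ℕ → X, IsGreedySequence K x := by
  have hmax : ∀ (n : ℕ) (p : Fin n → X), ∃ z : X, IsMaxOn (fun y : X =>
      (Matrix.of fun i j : Fin (n + 1) => K ((Fin.snoc p y : Fin (n + 1) → X) i,
        (Fin.snoc p y : Fin (n + 1) → X) j)).det) Set.univ z := by
    intro n p
    have hsnoc : ∀ i, Continuous fun y : X => (Fin.snoc p y : Fin (n + 1) → X) i := by
      intro i
      induction i using Fin.lastCases with
      | last => simpa using continuous_id'
      | cast i => simpa using continuous_const
    have hdet : Continuous fun y : X => (Matrix.of fun i j : Fin (n + 1) =>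
        K ((Fin.snoc p y : Fin (n + 1) → X) i, (Fin.snoc p y : Fin (n + 1) → X) j)).det := by
      refine Continuous.matrix_det (continuous_matrix fun i j => ?_)
      exact K.continuous.comp ((hsnoc i).prodMk (hsnoc j))
    obtain ⟨z, -, hz⟩ := isCompact_univ.exists_isMaxOn Set.univ_nonempty hdet.continuousOn
    exact ⟨z, hz⟩
  choose f hf using hmax
  refine ⟨recursiveSequence f, fun n => ?_⟩
  have h : recursiveSequence f n = f n fun k => recursiveSequence f k := by rw [recursiveSequence]
  rw [h]
  exact hf n _

namespace IsFeatureMap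

variable {X H : Type*} [TopologicalSpace X] [NormedAddCommGroup H] [InnerProductSpace ℝ H]
  {K : C(X × X, ℝ)} {Φ : X → H}

/-- The first factor does not involve y, so when it is positive the greedy choice maximizes the
distance of Φ y from the span of the earlier features. -/
theorem det_kernel_snoc (h : IsFeatureMap K Φ) {n : ℕ} (p : Fin n → X) (y : X) :
    (Matrix.of fun i j : Fin (n + 1) => K ((Fin.snoc p y : Fin (n + 1) → X) i,
        (Fin.snoc p y : Fin (n + 1) → X) j)).det
      = (Matrix.gram ℝ fun i => Φ (p i)).det *
        ‖Φ y - (Submodule.span ℝ (Set.range fun i => Φ (p i))).starProjection (Φ y)‖ ^ 2 := by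
  have h1 := det_gram_succ fun i => Φ ((Fin.snoc p y : Fin (n + 1) → X) i)
  simp only [Fin.snoc_castSucc, Fin.snoc_last] at h1
  rw [← h1]
  congr 1
  ext i j
  simp [Matrix.gram_apply, h.inner_eq]

/-- The determinants of a greedy sequence are bounded below by products of squared widths. -/
theorem prod_width_sq_le_det_gram (h : IsFeatureMap K Φ)
    (hw : ∀ n, 0 < kolmogorovWidth (Set.range Φ) n) {x : ℕ → X} (hx : IsGreedySequence K x)
    (n : ℕ) : ∏ k ∈ Finset.range n, kolmogorovWidth (Set.range Φ) k ^ 2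
      ≤ (Matrix.gram ℝ fun i : Fin n => Φ (x i)).det := by
  induction n with
  | zero => simp
  | succ n ih =>
    have hpos : 0 < (Matrix.gram ℝ fun i : Fin n => Φ (x i)).det :=
      (Finset.prod_pos fun k _ => pow_pos (hw k) 2).trans_le ih
    set L := Submodule.span ℝ (Set.range fun i : Fin n => Φ (x i)) with hL
    have h1 : ∀ y, ‖Φ y - L.starProjection (Φ y)‖ ≤ ‖Φ (x n) - L.starProjection (Φ (x n))‖ := by
      intro y
      have h2 := hx n (Set.mem_univ y)
      simp only [Set.mem_ofPred_eq, h.det_kernel_snoc] at h2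
      exact le_of_sq_le_sq (le_of_mul_le_mul_left h2 hpos) (norm_nonneg _)
    have hfin : Module.finrank ℝ L ≤ n :=
      (finrank_range_le_card (R := ℝ) fun i : Fin n => Φ (x i)).trans_eq (Fintype.card_fin n)
    have h3 := kolmogorovWidth_range_le hfin (norm_nonneg _) h1
    have h4 := det_gram_succ fun i : Fin (n + 1) => Φ (x i)
    simp only [Fin.val_castSucc, Fin.val_last] at h4
    rw [Finset.prod_range_succ, h4]
    gcongr
    exact (hw n).le

end IsFeatureMap

/-! ### Empirical measures and kernel matrices. -/

/-- The function `x ↦ (1/m) ∑ⱼ uⱼ K(x, xⱼ)`, as a linear function of `u`. -/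
noncomputable def kernelCombination {X : Type*} [TopologicalSpace X] (K : C(X × X, ℝ)) (x : ℕ → X)
    (m : ℕ+) :
    (Fin m → ℝ) →ₗ[ℝ] C(X, ℝ) where
  toFun u := ⟨fun y => (m : ℝ)⁻¹ * ∑ j : Fin m, K (y, x j) * u j,
    continuous_const.mul (continuous_finsetSum _ fun j _ => by fun_prop)⟩
  map_add' u v := by
    ext y
    simp [mul_add, Finset.sum_add_distrib]
  map_smul' c u := by
    ext y
    simp only [ContinuousMap.coe_mk, Pi.smul_apply, smul_eq_mul, ContinuousMap.smul_apply,
      RingHom.id_apply, Finset.mul_sum]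
    exact Finset.sum_congr rfl fun j _ => by ring

theorem kernelCombination_apply {X : Type*} [TopologicalSpace X] (K : C(X × X, ℝ)) (x : ℕ → X)
    (m : ℕ+) (u : Fin m → ℝ) (y : X) :
    kernelCombination K x m u y = (m : ℝ)⁻¹ * ∑ j : Fin m, K (y, x j) * u j := rfl

section Empirical

variable {X : Type*} [TopologicalSpace X] [CompactSpace X] [MeasurableSpace X] [BorelSpace X]

theorem integral_empiricalMeasure (x : ℕ → X) (m : ℕ+) (f : C(X, ℝ)) :
    ∫ y, f y ∂(empiricalMeasure x m) = (m : ℝ)⁻¹ * ∑ i : Fin m, f (x i) := by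
  have hf := f.continuous.stronglyMeasurable
  rw [empiricalMeasure, integral_smul_measure, integral_finsetSum_measure]
  · simp only [integral_dirac' _ _ hf]
    rw [Fin.sum_univ_eq_sum_range (fun i => f (x i)) m]
    simp
  · exact fun i _ => f.continuous.integrable_of_hasCompactSupport
      (HasCompactSupport.of_compactSpace _)

theorem integralToContinuous_toLp_empiricalMeasure [FirstCountableTopology X]
    (K : C(X × X, ℝ)) (x : ℕ → X) (m : ℕ+)
    (f : C(X, ℝ)) :
    integralToContinuous K (empiricalMeasure x m)
        (ContinuousMap.toLp 2 (empiricalMeasure x m) ℝ f)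
      = kernelCombination K x m fun i => f (x i) := by
  ext y
  change ∫ z, K (y, z) * ContinuousMap.toLp 2 (empiricalMeasure x m) ℝ f z
    ∂(empiricalMeasure x m) = _
  let g : C(X, ℝ) := ⟨fun z => K (y, z) * f z, by fun_prop⟩
  refine Eq.trans (integral_congr_ae ?_) (integral_empiricalMeasure x m g)
  filter_upwards [ContinuousMap.coeFn_toLp (p := 2) (𝕜 := ℝ) (empiricalMeasure x m) f] with z hz
  rw [hz]
  rfl

/-- The integral of f² is an average over the sample points, so it vanishes only if f does at each
of them. -/
theorem apply_eq_zero_of_toLp_empiricalMeasure_eq_zero {x : ℕ → X} {m : ℕ+} {f : C(X, ℝ)}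
    (hf : ContinuousMap.toLp 2 (empiricalMeasure x m) ℝ f = 0) (i : Fin m) : f (x i) = 0 := by
  have h1 : f =ᵐ[empiricalMeasure x m] 0 := by
    refine (ContinuousMap.coeFn_toLp (p := 2) (𝕜 := ℝ) (empiricalMeasure x m) f).symm.trans ?_
    rw [hf]
    exact Lp.coeFn_zero _ _ _
  have h2 : ∫ y, (f * f) y ∂(empiricalMeasure x m) = 0 := by
    refine integral_eq_zero_of_ae ?_
    filter_upwards [h1] with y hy
    simp [hy]
  rw [integral_empiricalMeasure] at h2
  have hm : (m : ℝ)⁻¹ ≠ 0 := by simp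
  have h3 := (mul_eq_zero.1 h2).resolve_left hm
  have h4 := (Finset.sum_eq_zero_iff_of_nonneg fun (i : Fin m) _ =>
    mul_self_nonneg (f (x i))).1 h3 i (Finset.mem_univ i)
  exact mul_self_eq_zero.1 h4

end Empirical

namespace IsFeatureMap

variable {X H : Type*} [TopologicalSpace X] [CompactSpace X] [SecondCountableTopology X]
  [MeasurableSpace X] [BorelSpace X] [NormedAddCommGroup H] [InnerProductSpace ℝ H]
  [CompleteSpace H] {K : C(X × X, ℝ)} {Φ : X → H}

/-- Linearly independent eigenvectors of the normalized kernel matrix with eigenvalues at least `t`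
bound the eigenvalues of the integral operator of the empirical measure from below. -/
theorem le_nthEigenvalue_empiricalMeasure (h : IsFeatureMap K Φ) (x : ℕ → X) (m : ℕ+) {n : ℕ}
    (hn : 1 ≤ n) {t : ℝ} (ht : 0 < t) {u : Fin n → Fin m → ℝ} {s : Fin n → ℝ}
    (hu : LinearIndependent ℝ u) (hs : ∀ k, t ≤ s k)
    (hus : ∀ k (i : Fin m), kernelCombination K x m (u k) (x i) = s k * u k i) :
    t ≤ nthEigenvalue (integralOperator K (empiricalMeasure x m)) n := by
  let P : C(X, ℝ) →L[ℝ] Lp ℝ 2 (empiricalMeasure x m) :=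
    ContinuousMap.toLp 2 (empiricalMeasure x m) ℝ
  -- An eigenvector u of the matrix extends to a continuous function on X whose values at the sample
  -- points are s u; since s > 0, independence survives.
  refine h.le_nthEigenvalue (empiricalMeasure x m) hn ht
    (v := fun k => P (kernelCombination K x m (u k))) ?_ fun k => ⟨s k, hs k, ?_⟩
  · rw [Fintype.linearIndependent_iff] at hu ⊢
    intro c hc k
    have h1 : P (kernelCombination K x m (∑ k, c k • u k)) = 0 := by
      simpa only [map_sum, map_smul] using hc
    have h2 : ∑ k, (c k * s k) • u k = 0 := by
      ext i
      have h3 := apply_eq_zero_of_toLp_empiricalMeasure_eq_zero h1 i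
      simp only [map_sum, map_smul, ContinuousMap.coe_sum, Finset.sum_apply,
        ContinuousMap.coe_smul, Pi.smul_apply, hus, smul_eq_mul] at h3
      simpa only [Finset.sum_apply, Pi.smul_apply, smul_eq_mul, Pi.zero_apply, mul_assoc] using h3
    exact (mul_eq_zero.1 (hu _ h2 k)).resolve_right (ht.trans_le (hs k)).ne'
  · change P (integralToContinuous K (empiricalMeasure x m) (P (kernelCombination K x m (u k))))
      = _
    rw [integralToContinuous_toLp_empiricalMeasure, ← map_smul, ← map_smul]
    congr 2
    ext i
    exact hus k i

/-- The determinant of the normalized kernel matrix is at most the product of the eigenvalues of the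
integral operator of the empirical measure. -/
theorem det_gram_div_le_prod_nthEigenvalue (h : IsFeatureMap K Φ) (x : ℕ → X) (m : ℕ+) :
    (Matrix.gram ℝ fun i : Fin m => Φ (x i)).det / (m : ℝ) ^ (m : ℕ)
      ≤ ∏ k ∈ Finset.range m,
        nthEigenvalue (integralOperator K (empiricalMeasure x m)) (k + 1) := by
  set A : Matrix (Fin m) (Fin m) ℝ := (m : ℝ)⁻¹ • Matrix.gram ℝ fun i : Fin m => Φ (x i) with hA
  have hpsd : A.PosSemidef := (Matrix.posSemidef_gram ℝ _).smul (by positivity)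
  have hdet : A.det = (Matrix.gram ℝ fun i : Fin m => Φ (x i)).det / (m : ℝ) ^ (m : ℕ) := by
    rw [hA, Matrix.det_smul, Fintype.card_fin, inv_pow, inv_mul_eq_div]
  have hH := hpsd.isHermitian
  have hmul : ∀ (u : Fin m → ℝ) i, A.mulVec u i = kernelCombination K x m u (x i) := by
    intro u i
    simp [hA, kernelCombination_apply, Matrix.mulVec, dotProduct, Matrix.gram_apply, h.inner_eq,
      Finset.mul_sum, mul_assoc]
  -- `eigenvalues₀` lists the eigenvalues in nonincreasing order, so its first i + 1 eigenvectors
  -- witness the bound for λ_{i+1}.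
  let e : Fin (Fintype.card (Fin m)) ≃ Fin m := Fintype.equivOfCardEq (Fintype.card_fin _)
  have he : ∀ i, hH.eigenvalues (e i) = hH.eigenvalues₀ i := fun i => by
    simp [Matrix.IsHermitian.eigenvalues, e]
  have hle : ∀ i : Fin (Fintype.card (Fin m)), hH.eigenvalues₀ i
      ≤ nthEigenvalue (integralOperator K (empiricalMeasure x m)) (i + 1) := by
    intro i
    rcases le_or_gt (hH.eigenvalues₀ i) 0 with h0 | h0
    · exact h0.trans (nthEigenvalue_nonneg _ _)
    let g : Fin (i + 1) → Fin m := fun k => e (Fin.castLE i.isLt k)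
    have hg : Function.Injective g := e.injective.comp (Fin.castLE_injective _)
    have hli : LinearIndependent ℝ fun k => (hH.eigenvectorBasis (g k)).ofLp :=
      (hH.eigenvectorBasis.orthonormal.linearIndependent.comp g hg).map'
        (WithLp.linearEquiv 2 ℝ (Fin m → ℝ)).toLinearMap (LinearEquiv.ker _)
    refine h.le_nthEigenvalue_empiricalMeasure x m (Nat.le_add_left 1 i) h0 hli
      (s := fun k => hH.eigenvalues (g k)) (fun k => ?_) fun k j => ?_
    · rw [he]
      exact hH.eigenvalues₀_antitone (Fin.le_def.2 (Nat.le_of_lt_succ k.isLt))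
    · rw [← hmul, hH.mulVec_eigenvectorBasis, Pi.smul_apply, smul_eq_mul]
  rw [← hdet, hH.det_eq_prod_eigenvalues]
  calc ∏ i, ((hH.eigenvalues i : ℝ)) = ∏ i, hH.eigenvalues₀ i := by
        rw [← Equiv.prod_comp e]
        exact Finset.prod_congr rfl fun i _ => he i
    _ ≤ ∏ i : Fin (Fintype.card (Fin m)),
        nthEigenvalue (integralOperator K (empiricalMeasure x m)) (i + 1) :=
      Finset.prod_le_prod (fun i _ => by rw [← he]; exact hpsd.eigenvalues_nonneg _)
        fun i _ => hle i
    _ = _ := by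
      rw [Fin.prod_univ_eq_prod_range
        (fun k => nthEigenvalue (integralOperator K (empiricalMeasure x m)) (k + 1)),
        Fintype.card_fin]

end IsFeatureMap

/-! ### Comparison of products and conclusion. -/

/-- If `∏_{k<m} w(k)² ≤ m^m ∏_{k≤m} Λ(m,k)` for all `m`, then `n Λ(m,n) ≤ c w(n)²` cannot hold for
all large `n` and all `m` with a constant `c < 1/e`. -/
theorem not_eventually_mul_le_of_prod_le {w : ℕ → ℝ} (hw : ∀ n, 0 < w n) {C : ℝ}
    (hC : ∀ n, w n ^ 2 ≤ C) {Λ : ℕ+ → ℕ → ℝ} (hΛ : ∀ m n, 0 ≤ Λ m n)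
    (hΛC : ∀ m n, 1 ≤ n → n * Λ m n ≤ C)
    (hprod : ∀ m : ℕ+, (∏ k ∈ Finset.range m, w k ^ 2) / (m : ℝ) ^ (m : ℕ)
      ≤ ∏ k ∈ Finset.range m, Λ m (k + 1))
    {c : ℝ} (hc : 0 < c) (hce : c < 1 / Real.exp 1) :
    ¬ ∀ᶠ n in atTop, ∀ m, n * Λ m n ≤ c * w n ^ 2 := by
  intro hev
  obtain ⟨N, hN⟩ := eventually_atTop.1 hev
  have hC0 : 0 < C := (pow_pos (hw 0) 2).trans_le (hC 0)
  set B := ∏ k ∈ Finset.range (N + 1), w k ^ 2 with hB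
  have hB0 : 0 < B := Finset.prod_pos fun k _ => pow_pos (hw k) 2
  have hce1 : c * Real.exp 1 < 1 := by rwa [lt_div_iff₀ (Real.exp_pos 1)] at hce
  -- Taken with m = N + 1 + j; the right side tends to 0 as j grows, while B > 0 is fixed.
  have key : ∀ j : ℕ, B ≤ C ^ (N + 1) * c * Real.exp 1 ^ (N + 1) * (c * Real.exp 1) ^ j := by
    intro j
    let m : ℕ+ := ⟨N + 1 + j, by omega⟩
    have hm : (m : ℕ) = N + 1 + j := rfl
    set P := ∏ k ∈ Finset.range j, w (N + 1 + k) ^ 2 with hP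
    have hP0 : 0 < P := Finset.prod_pos fun k _ => pow_pos (hw _) 2
    have h1 : ∏ k ∈ Finset.range m, w k ^ 2 = B * P := by
      rw [hm, Finset.prod_range_add]
    have h2 : ∏ k ∈ Finset.range m, (((k + 1 : ℕ) : ℝ) * Λ m (k + 1))
        = (m : ℕ).factorial * ∏ k ∈ Finset.range m, Λ m (k + 1) := by
      rw [Finset.prod_mul_distrib, ← Nat.cast_prod, Finset.prod_range_add_one_eq_factorial]
    -- The first N factors are at most C, the other j + 1 obey the assumed bound. Eigenvalues are
    -- indexed from 1 and widths from 0, so w(m)² is left over and costs one more C.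
    have h3 : ∏ k ∈ Finset.range m, (((k + 1 : ℕ) : ℝ) * Λ m (k + 1))
        ≤ C ^ N * (c ^ (j + 1) * (P * C)) := by
      have h4 : (m : ℕ) = N + (j + 1) := by omega
      rw [h4, Finset.prod_range_add]
      refine mul_le_mul ?_ ?_ (Finset.prod_nonneg fun k _ => mul_nonneg (by positivity) (hΛ _ _))
        (by positivity)
      · simpa using Finset.prod_le_prod (s := Finset.range N)
          (fun k _ => mul_nonneg (Nat.cast_nonneg (k + 1)) (hΛ m (k + 1)))
          fun k _ => hΛC m (k + 1) (Nat.le_add_left 1 k)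
      · have h5 := Finset.prod_le_prod (s := Finset.range (j + 1))
          (fun k _ => mul_nonneg (Nat.cast_nonneg (N + k + 1)) (hΛ m (N + k + 1)))
          fun k _ => hN (N + k + 1) (by omega) m
        refine h5.trans ?_
        rw [Finset.prod_mul_distrib, Finset.prod_const, Finset.card_range,
          Finset.prod_range_succ]
        have h6 : ∏ k ∈ Finset.range j, w (N + k + 1) ^ 2 = P :=
          Finset.prod_congr rfl fun k _ => by rw [Nat.add_right_comm]
        rw [h6]
        gcongr
        exact hC _
    have hmm : (0 : ℝ) < (m : ℝ) ^ (m : ℕ) := by positivity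
    have hf : (0 : ℝ) < (m : ℕ).factorial := by positivity
    have h7 : B * P / (m : ℝ) ^ (m : ℕ) * (m : ℕ).factorial ≤ C ^ N * (c ^ (j + 1) * (P * C)) := by
      refine le_trans ?_ h3
      rw [h2, ← h1, mul_comm]
      exact mul_le_mul_of_nonneg_left (hprod m) hf.le
    -- m^m / m! is a single term of the series of e^m; this is the source of 1/e.
    have h8 : (m : ℝ) ^ (m : ℕ) / (m : ℕ).factorial ≤ Real.exp 1 ^ (m : ℕ) := by
      have := Real.pow_div_factorial_le_exp (m : ℝ) (by positivity) (m : ℕ)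
      rwa [← mul_one ((m : ℕ) : ℝ), Real.exp_nat_mul, mul_one] at this
    have h9 : B ≤ C ^ N * (c ^ (j + 1) * C) * ((m : ℝ) ^ (m : ℕ) / (m : ℕ).factorial) := by
      have h10 : B * P / (m : ℝ) ^ (m : ℕ) * (m : ℕ).factorial
          = B / ((m : ℝ) ^ (m : ℕ) / (m : ℕ).factorial) * P := by
        field_simp
      rw [h10, show C ^ N * (c ^ (j + 1) * (P * C)) = C ^ N * (c ^ (j + 1) * C) * P by ring] at h7
      have h11 := le_of_mul_le_mul_right h7 hP0
      rwa [div_le_iff₀ (by positivity)] at h11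
    calc B ≤ C ^ N * (c ^ (j + 1) * C) * ((m : ℝ) ^ (m : ℕ) / (m : ℕ).factorial) := h9
      _ ≤ C ^ N * (c ^ (j + 1) * C) * Real.exp 1 ^ (m : ℕ) := by gcongr
      _ = _ := by rw [hm, mul_pow, pow_add (Real.exp 1)]; ring
  have hlim := (tendsto_pow_atTop_nhds_zero_of_lt_one (by positivity) hce1).const_mul
    (C ^ (N + 1) * c * Real.exp 1 ^ (N + 1))
  rw [mul_zero] at hlim
  exact hB0.not_ge (ge_of_tendsto' hlim key)

namespace IsFeatureMap

variable {X H : Type*} [TopologicalSpace X] [CompactSpace X] [SecondCountableTopology X]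
  [MeasurableSpace X] [BorelSpace X] [NormedAddCommGroup H] [InnerProductSpace ℝ H]
  [CompleteSpace H] {K : C(X × X, ℝ)} {Φ : X → H}

theorem inv_exp_le_limsup_empiricalMeasure (h : IsFeatureMap K Φ)
    (hw : ∀ n, 0 < kolmogorovWidth (Set.range Φ) n) {x : ℕ → X} (hx : IsGreedySequence K x) :
    ((1 / Real.exp 1 : ℝ) : EReal) ≤
      limsup (fun n : ℕ => ⨆ m : ℕ+,
        ((n * nthEigenvalue (integralOperator K (empiricalMeasure x m)) n
          / kolmogorovWidth (Set.range Φ) n ^ 2 : ℝ) : EReal)) atTop := by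
  by_contra hlt
  obtain ⟨c, hc1, hc2⟩ := EReal.lt_iff_exists_real_btwn.1 (not_le.1 hlt)
  have hce : c < 1 / Real.exp 1 := EReal.coe_lt_coe_iff.1 hc2
  have hexp : 0 < 1 / Real.exp 1 := by positivity
  refine not_eventually_mul_le_of_prod_le hw h.kolmogorovWidth_sq_le
    (Λ := fun m n => nthEigenvalue (integralOperator K (empiricalMeasure x m)) n)
    (fun m n => nthEigenvalue_nonneg _ n) (fun m n hn => h.mul_nthEigenvalue_le _ hn)
    -- The real number c obtained above may be nonpositive; the maximum makes the constant positive
    -- and keeps it below 1/e.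
    (fun m => ?_) (c := max c (1 / Real.exp 1 / 2)) (lt_max_of_lt_right (half_pos hexp))
    (max_lt hce (half_lt_self hexp)) ?_
  · refine le_trans ?_ (h.det_gram_div_le_prod_nthEigenvalue x m)
    gcongr
    exact h.prod_width_sq_le_det_gram hw hx m
  · filter_upwards [eventually_lt_of_limsup_lt hc1] with n hn m
    have h1 := ((le_iSup (fun m : ℕ+ =>
      ((n * nthEigenvalue (integralOperator K (empiricalMeasure x m)) n
        / kolmogorovWidth (Set.range Φ) n ^ 2 : ℝ) : EReal)) m).trans_lt hn).le
    rw [EReal.coe_le_coe_iff, div_le_iff₀ (pow_pos (hw n) 2)] at h1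
    refine h1.trans ?_
    gcongr
    exact le_max_left _ _

end IsFeatureMap

theorem isFeatureMap_kerFun {X : Type*} [TopologicalSpace X] (K : C(X × X, ℝ))
    [Fact (kernelMatrix (K : X × X → ℝ)).PosSemidef] :
    IsFeatureMap K fun x : X => RKHS.kerFun (RKHS.OfKernel (kernelMatrix (K : X × X → ℝ))) x
      (1 : ℝ) where
  inner_eq x y := by
    rw [RKHS.kerFun_inner, kerFun_kernelMatrix]
    simp

theorem theorem3 {d : ℕ} (Ω : Set (EuclideanSpace ℝ (Fin d))) [CompactSpace Ω]
    (K : C(Ω × Ω, ℝ)) (hK : IsPosSemidefKernel K) :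
    (∀ (μ : Measure Ω) [IsProbabilityMeasure μ] (n : ℕ), 1 ≤ n →
      nthEigenvalue (integralOperator K μ) (2 * n) ≤ kernelWidth K hK n ^ 2 / n) ∧
    ((∀ n : ℕ, 0 < kernelWidth K hK n) →
      (((1 / Real.exp 1 : ℝ) : EReal) ≤
        limsup (fun n : ℕ => ⨆ μ : ProbabilityMeasure Ω,
          ((n * nthEigenvalue (integralOperator K (μ : Measure Ω)) n
            / kernelWidth K hK n ^ 2 : ℝ) : EReal)) atTop) ∧
      (∃ x : ℕ → Ω, IsGreedySequence K x) ∧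
      (∀ x : ℕ → Ω, IsGreedySequence K x →
        ((1 / Real.exp 1 : ℝ) : EReal) ≤
          limsup (fun n : ℕ => ⨆ m : ℕ+,
            ((n * nthEigenvalue (integralOperator K (empiricalMeasure x m)) n
              / kernelWidth K hK n ^ 2 : ℝ) : EReal)) atTop)) := by
  have hfact : Fact (kernelMatrix (K : Ω × Ω → ℝ)).PosSemidef := ⟨posSemidef_kernelMatrix hK⟩
  have h := isFeatureMap_kerFun K
  refine ⟨fun μ _ n hn => h.nthEigenvalue_two_mul_le μ hn, fun hw => ?_⟩
  -- On an empty Ω all widths would be 0; a greedy sequence needs a point.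
  have hne : Nonempty Ω := by
    by_contra hemp
    rw [not_nonempty_iff] at hemp
    have := kolmogorovWidth_range_le (Φ := fun x : Ω =>
      RKHS.kerFun (RKHS.OfKernel (kernelMatrix (K : Ω × Ω → ℝ))) x (1 : ℝ)) (L := ⊥) (n := 0)
      (by simp) le_rfl (fun x => hemp.elim x)
    exact (hw 0).not_ge this
  obtain ⟨x, hx⟩ := exists_isGreedySequence K
  have hgreedy : ∀ x : ℕ → Ω, IsGreedySequence K x → _ := fun x hx =>
    h.inv_exp_le_limsup_empiricalMeasure hw hx
  refine ⟨(hgreedy x hx).trans (limsup_le_limsup (Eventually.of_forall fun n => ?_)), ⟨x, hx⟩,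
    hgreedy⟩
  exact iSup_le fun m => le_iSup (fun μ : ProbabilityMeasure Ω =>
    ((n * nthEigenvalue (integralOperator K (μ : Measure Ω)) n
      / kernelWidth K hK n ^ 2 : ℝ) : EReal)) ⟨empiricalMeasure x m, inferInstance⟩
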